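/- For a positive integer $n$ write $[n]=\{1,\dots,n\}$. An $r$-graph $G=([n],E)$ on $[n]$ is a set $E=E(G)$ of $r$-element subsets of $[n]$. Its graph-Lagrangian is $$\lambda(G)=\max\Big\{\sum_{\{i_1,\dots,i_r\}\in E(G)}x_{i_1}\cdots x_{i_r}\;:\;x_1,\dots,x_n\ge 0,\ x_1+\dots+x_n=1\Big\}.$$ $G$ is left-compressed if for all $1\le i<j\le n$ and every $A\subseteq[n]\setminus\{i,j\}$ with $A\cup\{j\}\in E$ one has $A\cup\{i\}\in E$. In the colex ordering of the $r$-element subsets of $\{1,2,3,\dots\}$, $A<B$ means $A\ne B$ and $\max(A\triangle B)\in B$; $C_{r,m}$ denotes the $r$-graph whose edges are the first $m$ sets in this ordering, on the vertex set $[N]$, where $N$ is the largest integer contained in an edge. **Theorem.** Let $m,t,a$ and $r\ge 4$ be positive integers with $m=\binom{t}{r}-a$ and $12\le a\le t-r+1$. Let $G=([t],E)$ be a left-compressed $r$-graph with $m$ edges. If $|E(G)\triangle E(C_{r,m})|\le 4$, then $\lambda(G)\le\lambda(C_{r,m})$. -/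

import Mathlib

open Finset
open scoped symmDiff

/-- An `r`-uniform hypergraph (`r`-graph) on the vertex set `[n] = {1, …, n}`: a set of
`r`-element subsets of `[n]`. -/
structure RGraph (r n : ℕ) where
  edges : Finset (Finset ℕ)
  edges_subset : edges ⊆ (Icc 1 n).powersetCard r

namespace RGraph

variable {r n : ℕ}

/-- The polynomial `λ(G, x) = ∑_{i₁ ⋯ iᵣ ∈ E(G)} x_{i₁} ⋯ x_{iᵣ}`. Only the values of `x` on `[n]`
matter. -/
def lagrangePoly (G : RGraph r n) (x : ℕ → ℝ) : ℝ := ∑ e ∈ G.edges, ∏ i ∈ e, x i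

/-- The feasible weightings: `x₁ + ⋯ + xₙ = 1` and `xᵢ ≥ 0` for `i = 1, …, n`. -/
def simplex (n : ℕ) : Set (ℕ → ℝ) := {x | ∑ i ∈ Icc 1 n, x i = 1 ∧ ∀ i ∈ Icc 1 n, 0 ≤ x i}

/-- The graph-Lagrangian `λ(G)`: the maximum of `λ(G, x)` over the simplex (for `n ≥ 1` it is
attained, see `isGreatest_lagrangian`). -/
noncomputable def lagrangian (G : RGraph r n) : ℝ := sSup (G.lagrangePoly '' simplex n)

theorem isGreatest_lagrangian (G : RGraph r n) (hn : 1 ≤ n) :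
    IsGreatest (G.lagrangePoly '' simplex n) G.lagrangian := by
  classical
  let ext : (↥(Icc 1 n) → ℝ) → (ℕ → ℝ) := fun y i => if h : i ∈ Icc 1 n then y ⟨i, h⟩ else 0
  have hext : Continuous ext := by
    refine continuous_pi fun i => ?_
    by_cases h : i ∈ Icc 1 n
    · simp only [ext, h, dite_true]; fun_prop
    · simp only [ext, h, dite_false]; fun_prop
  have hpoly : Continuous G.lagrangePoly := by unfold lagrangePoly; fun_prop
  have himg : G.lagrangePoly '' simplex n
      = (fun y => G.lagrangePoly (ext y)) '' stdSimplex ℝ ↥(Icc 1 n) := by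
    ext v
    constructor
    · rintro ⟨x, ⟨hx1, hx0⟩, rfl⟩
      refine ⟨fun i => x i, ⟨fun i => hx0 _ i.2, ?_⟩, ?_⟩
      · rw [← hx1]; exact Finset.sum_coe_sort (Icc 1 n) x
      · refine Finset.sum_congr rfl fun e he => Finset.prod_congr rfl fun i hi => ?_
        have := (Finset.mem_powersetCard.1 (G.edges_subset he)).1 hi
        simp only [ext, this, dite_true]
    · rintro ⟨y, ⟨hy0, hy1⟩, rfl⟩
      refine ⟨ext y, ⟨?_, ?_⟩, rfl⟩
      · rw [← hy1, ← Finset.sum_coe_sort (Icc 1 n) (ext y)]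
        refine Finset.sum_congr rfl fun i _ => ?_
        simp only [ext, i.2, dite_true]
      · intro i hi
        simp only [ext, hi, dite_true]
        exact hy0 _
  have hne : (stdSimplex ℝ ↥(Icc 1 n)).Nonempty :=
    ⟨_, single_mem_stdSimplex ℝ (⟨1, by simp [hn]⟩ : ↥(Icc 1 n))⟩
  unfold lagrangian
  rw [himg]
  exact ((isCompact_stdSimplex ℝ ↥(Icc 1 n)).image (hpoly.comp hext)).isGreatest_sSup
    (hne.image _)

/-- `G` is left-compressed: for `1 ≤ i < j ≤ n` the set `E_{j∖i}` of those `A` that avoid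
`i` and `j` and satisfy `A ∪ {j} ∈ E`, `A ∪ {i} ∉ E` is empty. Equivalently, `j₁ ⋯ jᵣ ∈ E` implies
`i₁ ⋯ iᵣ ∈ E` whenever `iₚ ≤ jₚ` for every `p`. -/
def LeftCompressed (G : RGraph r n) : Prop :=
  ∀ i j : ℕ, 1 ≤ i → i < j → j ≤ n → ∀ A : Finset ℕ, i ∉ A → j ∉ A →
    insert j A ∈ G.edges → insert i A ∈ G.edges

end RGraph

/-- The first `m` sets of `{1, 2, 3, …}^{(r)}` in the colex ordering (in which `A < B` when
`max (A ∆ B) ∈ B`): the sets with fewer than `m` predecessors. For `r ≥ 1` they all lie in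
`[m + r]`; see `mem_colexSegment_of_lt` and `card_colexSegment`. -/
def colexSegment (r m : ℕ) : Finset (Finset ℕ) :=
  {A ∈ (Icc 1 (m + r)).powersetCard r |
    #{B ∈ (Icc 1 (m + r)).powersetCard r | toColex B < toColex A} < m}

/-- `C_{r,m}`: the `r`-graph whose edges are the first `m` sets in the colex ordering; its vertex
set is `[N]` for the largest vertex `N` that lies in an edge. -/
def colexGraph (r m : ℕ) : RGraph r ((colexSegment r m).sup fun A => A.sup id) where
  edges := colexSegment r m
  edges_subset := by
    intro A hA
    have hA' := mem_powersetCard.1 (mem_filter.1 hA).1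
    refine mem_powersetCard.2 ⟨fun i hi => mem_Icc.2 ⟨(mem_Icc.1 (hA'.1 hi)).1, ?_⟩, hA'.2⟩
    exact (Finset.le_sup (f := id) hi).trans
      (Finset.le_sup (f := fun A : Finset ℕ => A.sup id) hA)

/-- `colexSegment r m` is an initial segment of all `r`-subsets of `{1, 2, …}`. -/
theorem mem_colexSegment_of_lt {r m : ℕ} {A B : Finset ℕ} (hA : A ∈ colexSegment r m)
    (hB : ∀ i ∈ B, 1 ≤ i) (hBr : #B = r) (hlt : toColex B < toColex A) :
    B ∈ colexSegment r m := by
  unfold colexSegment at hA ⊢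
  obtain ⟨h1, h2⟩ := mem_filter.1 hA
  obtain ⟨h3, h4⟩ := mem_powersetCard.1 h1
  refine mem_filter.2 ⟨mem_powersetCard.2 ⟨fun i hi => mem_Icc.2 ⟨hB i hi, ?_⟩, hBr⟩, ?_⟩
  · exact Finset.Colex.forall_le_mono hlt.le (fun b hb => (mem_Icc.1 (h3 hb)).2) i hi
  · refine lt_of_le_of_lt (card_le_card fun X hX => ?_) h2
    rw [mem_filter] at hX ⊢
    exact ⟨hX.1, hX.2.trans hlt⟩

/-- `colexSegment r m` has exactly `m` elements. -/
theorem card_colexSegment {r : ℕ} (m : ℕ) (hr : 1 ≤ r) : #(colexSegment r m) = m := by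
  have hcard : m ≤ #((Icc 1 (m + r)).powersetCard r) := by
    rw [card_powersetCard, Nat.card_Icc, Nat.add_sub_cancel]
    have h1 : (m + 1).choose 1 ≤ (m + r).choose r := by
      rw [Nat.choose_one_right]
      calc m + 1 = (m + 1).choose m := (Nat.choose_succ_self_right m).symm
        _ ≤ (m + r).choose m := Nat.choose_le_choose m (by omega)
        _ = (m + r).choose r := Nat.choose_symm_add
    simp at h1
    omega
  have key : ∀ (S : Finset (Colex (Finset ℕ))), m ≤ #S →
      #{A ∈ S | #{B ∈ S | B < A} < m} = m := by
    intro S hS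
    let f := S.orderEmbOfFin rfl
    have hrank : ∀ k : Fin #S, #{B ∈ S | B < f k} = k := by
      intro k
      have : {B ∈ S | B < f k} = (Finset.Iio k).map f.toEmbedding := by
        ext B
        simp only [mem_filter, Finset.mem_map, Finset.mem_Iio]
        constructor
        · rintro ⟨hB, hlt⟩
          have : B ∈ Set.range f := by rw [Finset.range_orderEmbOfFin]; exact hB
          obtain ⟨l, rfl⟩ := this
          exact ⟨l, f.lt_iff_lt.1 hlt, rfl⟩
        · rintro ⟨l, hl, rfl⟩
          exact ⟨Finset.orderEmbOfFin_mem S rfl l, f.lt_iff_lt.2 hl⟩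
      rw [this, card_map, Fin.card_Iio]
    have : {A ∈ S | #{B ∈ S | B < A} < m}
        = (univ.filter fun k : Fin #S => (k : ℕ) < m).map f.toEmbedding := by
      ext A
      simp only [mem_filter, Finset.mem_map, mem_univ, true_and]
      constructor
      · rintro ⟨hA, hlt⟩
        have : A ∈ Set.range f := by rw [Finset.range_orderEmbOfFin]; exact hA
        obtain ⟨l, rfl⟩ := this
        exact ⟨l, by rwa [hrank] at hlt, rfl⟩
      · rintro ⟨l, hl, rfl⟩
        exact ⟨Finset.orderEmbOfFin_mem S rfl l, by erw [hrank]; exact hl⟩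
    rw [this, card_map, Fin.card_filter_val_lt]
    omega
  have h2 := key (((Icc 1 (m + r)).powersetCard r).map toColex.toEmbedding) (by rwa [card_map])
  rw [Finset.filter_map, card_map] at h2
  refine Eq.trans ?_ h2
  unfold colexSegment
  congr 1
  refine Finset.filter_congr fun A _ => ?_
  simp only [Function.comp]
  rw [Finset.filter_map, card_map]
  rfl

/-! Put p = t - r + 1 and T = [p+1, t], and let F be the family of the a non-edges of G. The
non-edges of C_{r,m} are the a sets {k} ∪ T with p - a < k ≤ p (`colexSegment_eq`). The two graphs
have equally many edges, so at most two members of F lie outside this family. F is closed under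
upward shifts, which leaves only three candidates for such members (`eq_of_mem_sdiff_colexTop`).

Let x be an optimal weighting of G. If some weight is 0, it can be moved to vertex t, which lies in
every non-edge of C_{r,m}, so nothing is lost by passing to C_{r,m} (`exists_edgeSum_le_of_zero`).
Otherwise all weights are positive, and stationarity makes them non-increasing. With Q the product
of the weights on [p+2, t], each non-edge of C_{r,m} that is an edge of G weighs at most x_1 x_{p+1}
Q, and each of the equally many exceptional non-edges of G weighs at least x_p² Q. So x_1 x_{p+1} ≤
x_p² (`mul_le_sq_of_isMax`) shows that C_{r,m} has at least the weight of G at the same x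
(`edgeSum_le_of_isMax`).

That inequality comes from stationarity for the pairs (1, p+2), (p, p+1) and (1, p): the first keeps
the weights up to p+2 within a factor 0.78 of x_1, the second forces a drop from x_p to x_{p+1}, and
the third limits the drop from x_1 to x_p. -/

/-! ### Links and the dependence of the polynomial on two variables -/

/-- The sets `A` avoiding `i` and `j` with `A ∪ {i} ∈ E`. -/
def linkAvoiding (E : Finset (Finset ℕ)) (i j : ℕ) : Finset (Finset ℕ) :=
  {e ∈ E | i ∈ e ∧ j ∉ e}.image (·.erase i)

/-- The sets `B` avoiding `i` and `j` with `B ∪ {i, j} ∈ E`. -/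
def pairLink (E : Finset (Finset ℕ)) (i j : ℕ) : Finset (Finset ℕ) :=
  {e ∈ E | i ∈ e ∧ j ∈ e}.image fun e => (e.erase i).erase j

/-- `∑_{e ∈ E} ∏_{k ∈ e} x_k`. -/
def edgeSum (E : Finset (Finset ℕ)) (x : ℕ → ℝ) : ℝ := ∑ e ∈ E, ∏ k ∈ e, x k

theorem mem_linkAvoiding {E : Finset (Finset ℕ)} {i j : ℕ} (hij : i ≠ j) {A : Finset ℕ} :
    A ∈ linkAvoiding E i j ↔ i ∉ A ∧ j ∉ A ∧ insert i A ∈ E := by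
  simp only [linkAvoiding, mem_image, mem_filter]
  constructor
  · rintro ⟨e, ⟨he, hi, hj⟩, rfl⟩
    refine ⟨notMem_erase _ _, fun h => hj (mem_of_mem_erase h), ?_⟩
    rwa [insert_erase hi]
  · rintro ⟨hi, hj, h⟩
    refine ⟨insert i A, ⟨h, mem_insert_self _ _, ?_⟩, erase_insert hi⟩
    simp [hj, hij.symm]

theorem mem_pairLink {E : Finset (Finset ℕ)} {i j : ℕ} (hij : i ≠ j) {B : Finset ℕ} :
    B ∈ pairLink E i j ↔ i ∉ B ∧ j ∉ B ∧ insert i (insert j B) ∈ E := by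
  simp only [pairLink, mem_image, mem_filter]
  constructor
  · rintro ⟨e, ⟨he, hi, hj⟩, rfl⟩
    refine ⟨fun h => notMem_erase _ _ (mem_of_mem_erase h), notMem_erase _ _, ?_⟩
    rwa [insert_erase (mem_erase.2 ⟨hij.symm, hj⟩), insert_erase hi]
  · rintro ⟨hi, hj, h⟩
    refine ⟨insert i (insert j B), ⟨h, mem_insert_self _ _, by simp⟩, ?_⟩
    rw [erase_insert (by simp [hi, hij]), erase_insert hj]

theorem sum_link (E : Finset (Finset ℕ)) (x : ℕ → ℝ) (i j : ℕ) :
    ∑ e ∈ E with i ∈ e ∧ j ∉ e, ∏ k ∈ e, x k = x i * edgeSum (linkAvoiding E i j) x := by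
  rw [edgeSum, linkAvoiding, sum_image, mul_sum]
  · refine sum_congr rfl fun e he => ?_
    rw [mul_prod_erase _ _ (mem_filter.1 he).2.1]
  · intro e he f hf h
    rw [← insert_erase (mem_filter.1 he).2.1, ← insert_erase (mem_filter.1 hf).2.1]
    exact congrArg _ h

theorem sum_pairLink (E : Finset (Finset ℕ)) (x : ℕ → ℝ) {i j : ℕ} (hij : i ≠ j) :
    ∑ e ∈ E with i ∈ e ∧ j ∈ e, ∏ k ∈ e, x k = x i * x j * edgeSum (pairLink E i j) x := by
  rw [edgeSum, pairLink, sum_image, mul_sum]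
  · refine sum_congr rfl fun e he => ?_
    have h := (mem_filter.1 he).2
    rw [mul_assoc, mul_prod_erase _ _ (mem_erase.2 ⟨hij.symm, h.2⟩), mul_prod_erase _ _ h.1]
  · intro e he f hf h
    have h1 := (mem_filter.1 he).2
    have h2 := (mem_filter.1 hf).2
    rw [← insert_erase h1.1, ← insert_erase h2.1,
      ← insert_erase (mem_erase.2 ⟨hij.symm, h1.2⟩), ← insert_erase (mem_erase.2 ⟨hij.symm, h2.2⟩)]
    exact congrArg _ (congrArg _ h)

/-- None of the four inner sums involves x_i or x_j, so a transfer of weight between i and j is a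
quadratic problem. -/
theorem edgeSum_split (E : Finset (Finset ℕ)) (x : ℕ → ℝ) {i j : ℕ} (hij : i ≠ j) :
    edgeSum E x = x i * x j * edgeSum (pairLink E i j) x + x i * edgeSum (linkAvoiding E i j) x
      + x j * edgeSum (linkAvoiding E j i) x + edgeSum {e ∈ E | i ∉ e ∧ j ∉ e} x := by
  rw [← sum_link, ← sum_link, ← sum_pairLink E x hij, edgeSum,
    ← sum_filter_add_sum_filter_not E (i ∈ ·), ← sum_filter_add_sum_filter_not {e ∈ E | i ∈ e} (j ∈ ·),
    ← sum_filter_add_sum_filter_not {e ∈ E | i ∉ e} (j ∈ ·)]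
  simp only [filter_filter, edgeSum, add_assoc]
  congr 3
  refine sum_congr ?_ fun _ _ => rfl
  ext e
  simp only [mem_filter]
  tauto

theorem edgeSum_congr {E : Finset (Finset ℕ)} {x y : ℕ → ℝ}
    (h : ∀ e ∈ E, ∀ k ∈ e, x k = y k) : edgeSum E x = edgeSum E y :=
  sum_congr rfl fun e he => prod_congr rfl (h e he)

theorem edgeSum_nonneg {E : Finset (Finset ℕ)} {x : ℕ → ℝ} (h : ∀ e ∈ E, ∀ k ∈ e, 0 ≤ x k) :
    0 ≤ edgeSum E x :=
  sum_nonneg fun e he => prod_nonneg (h e he)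

/-! ### First-order optimality -/

/-- Moving weight s from j to i changes the polynomial by s c - s² L, which is nonpositive at a
maximum. Small s of both signs then kill the linear term. -/
theorem eq_zero_of_forall_abs_le {c L η : ℝ} (hη : 0 < η)
    (h : ∀ s, |s| ≤ η → s * c ≤ s ^ 2 * L) : c = 0 := by
  have key : ∀ c : ℝ, (∀ s, |s| ≤ η → s * c ≤ s ^ 2 * L) → c ≤ 0 := by
    intro c h
    by_contra! hc
    have hL : 0 < |L| + 1 := by positivity
    set s := min η (c / (2 * (|L| + 1))) with hs
    have hs0 : 0 < s := lt_min hη (by positivity)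
    have h1 := h s (by rw [abs_of_pos hs0]; exact min_le_left _ _)
    have h2 : s * (|L| + 1) ≤ c / 2 := by
      calc s * (|L| + 1) ≤ c / (2 * (|L| + 1)) * (|L| + 1) := by
            gcongr; exact min_le_right _ _
        _ = c / 2 := by field_simp
    have h3 : c ≤ s * L := by
      have : s * c ≤ s * (s * L) := by linarith [h1, sq s, mul_assoc s s L]
      exact le_of_mul_le_mul_left this hs0
    nlinarith [le_abs_self L, abs_nonneg L]
  refine le_antisymm (key c h) ?_
  have := key (-c) fun s hs => by
    have := h (-s) (by rwa [abs_neg])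
    linarith [neg_sq s]
  linarith

/-- First-order optimality along the direction `eᵢ - eⱼ`. -/
theorem RGraph.stationary {r n : ℕ} (G : RGraph r n) {x : ℕ → ℝ} (hx : x ∈ RGraph.simplex n)
    (hmax : ∀ y ∈ RGraph.simplex n, G.lagrangePoly y ≤ G.lagrangePoly x) {i j : ℕ} (hij : i ≠ j)
    (hi : i ∈ Icc 1 n) (hj : j ∈ Icc 1 n) (hxi : 0 < x i) (hxj : 0 < x j) :
    (x i - x j) * edgeSum (pairLink G.edges i j) x
      = edgeSum (linkAvoiding G.edges i j) x - edgeSum (linkAvoiding G.edges j i) x := by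
  have key := eq_zero_of_forall_abs_le (c := (x j - x i) * edgeSum (pairLink G.edges i j) x
    + edgeSum (linkAvoiding G.edges i j) x - edgeSum (linkAvoiding G.edges j i) x)
    (L := edgeSum (pairLink G.edges i j) x) (lt_min hxi hxj) ?_
  · linarith
  intro s hs
  rw [le_min_iff, abs_le, abs_le] at hs
  set y : ℕ → ℝ := fun k => if k = i then x i + s else if k = j then x j - s else x k with hy
  have hyi : y i = x i + s := by simp [hy]
  have hyj : y j = x j - s := by simp [hy, hij.symm]
  have hyk : ∀ k, k ≠ i → k ≠ j → x k = y k := fun k h1 h2 => by simp [hy, h1, h2]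
  have hys : y ∈ RGraph.simplex n := by
    refine ⟨?_, fun k hk => ?_⟩
    · rw [← hx.1, ← add_sum_erase _ _ hi, ← add_sum_erase _ x hi,
        ← add_sum_erase _ _ (mem_erase.2 ⟨hij.symm, hj⟩),
        ← add_sum_erase _ x (mem_erase.2 ⟨hij.symm, hj⟩), hyi, hyj,
        sum_congr rfl fun k hk => (hyk k ?_ ?_).symm]
      · ring
      · exact (mem_erase.1 (mem_erase.1 hk).2).1
      · exact (mem_erase.1 hk).1
    · by_cases h1 : k = i
      · rw [h1, hyi]; linarith
      by_cases h2 : k = j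
      · rw [h2, hyj]; linarith
      rw [← hyk k h1 h2]
      exact hx.2 k hk
  have h := hmax y hys
  change edgeSum G.edges y ≤ edgeSum G.edges x at h
  rw [edgeSum_split G.edges x hij, edgeSum_split G.edges y hij, hyi, hyj] at h
  have e1 : edgeSum (pairLink G.edges i j) y = edgeSum (pairLink G.edges i j) x :=
    edgeSum_congr fun e he k hk => by
      rw [mem_pairLink hij] at he
      exact (hyk k (fun h => he.1 (h ▸ hk)) (fun h => he.2.1 (h ▸ hk))).symm
  have e2 : edgeSum (linkAvoiding G.edges i j) y = edgeSum (linkAvoiding G.edges i j) x :=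
    edgeSum_congr fun e he k hk => by
      rw [mem_linkAvoiding hij] at he
      exact (hyk k (fun h => he.1 (h ▸ hk)) (fun h => he.2.1 (h ▸ hk))).symm
  have e3 : edgeSum (linkAvoiding G.edges j i) y = edgeSum (linkAvoiding G.edges j i) x :=
    edgeSum_congr fun e he k hk => by
      rw [mem_linkAvoiding hij.symm] at he
      exact (hyk k (fun h => he.2.1 (h ▸ hk)) (fun h => he.1 (h ▸ hk))).symm
  have e4 : edgeSum {e ∈ G.edges | i ∉ e ∧ j ∉ e} y = edgeSum {e ∈ G.edges | i ∉ e ∧ j ∉ e} x :=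
    edgeSum_congr fun e he k hk => by
      have he := (mem_filter.1 he).2
      exact (hyk k (fun h => he.1 (h ▸ hk)) (fun h => he.2 (h ▸ hk))).symm
  rw [e1, e2, e3, e4] at h
  linarith

theorem RGraph.LeftCompressed.link_subset {r n : ℕ} {G : RGraph r n} (hG : G.LeftCompressed)
    {i j : ℕ} (hi : 1 ≤ i) (hij : i < j) (hj : j ≤ n) :
    linkAvoiding G.edges j i ⊆ linkAvoiding G.edges i j := by
  intro A hA
  rw [mem_linkAvoiding hij.ne'] at hA
  rw [mem_linkAvoiding hij.ne]
  exact ⟨hA.2.1, hA.1, hG i j hi hij hj A hA.2.1 hA.1 hA.2.2⟩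

/-- The links are nested, so the difference of their weights is a sum of nonnegative terms, one for
each A such that A ∪ {i} is an edge and A ∪ {j} is not. -/
theorem RGraph.LeftCompressed.stationary {r n : ℕ} {G : RGraph r n} (hG : G.LeftCompressed)
    {x : ℕ → ℝ} (hx : x ∈ RGraph.simplex n)
    (hmax : ∀ y ∈ RGraph.simplex n, G.lagrangePoly y ≤ G.lagrangePoly x)
    (hpos : ∀ k ∈ Icc 1 n, 0 < x k) {i j : ℕ}
    (hi : 1 ≤ i) (hij : i < j) (hj : j ≤ n) :
    (x i - x j) * edgeSum (pairLink G.edges i j) x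
      = edgeSum (linkAvoiding G.edges i j \ linkAvoiding G.edges j i) x := by
  have hi' : i ∈ Icc 1 n := mem_Icc.2 ⟨hi, by omega⟩
  have hj' : j ∈ Icc 1 n := mem_Icc.2 ⟨by omega, hj⟩
  rw [G.stationary hx hmax hij.ne hi' hj' (hpos i hi') (hpos j hj'), edgeSum, edgeSum, edgeSum,
    ← sum_sdiff (hG.link_subset hi hij hj)]
  ring

/-- Weight of the edges through `k` and `j` is at most that of the edges through `k` and `i`. -/
theorem RGraph.LeftCompressed.pair_le {r n : ℕ} {G : RGraph r n} (hG : G.LeftCompressed)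
    {x : ℕ → ℝ} (hpos : ∀ k ∈ Icc 1 n, 0 < x k) {i j k : ℕ} (hi : 1 ≤ i) (hij : i < j)
    (hj : j ≤ n) (hki : k ≠ i) (hkj : k ≠ j) (hx : x j ≤ x i) :
    ∑ e ∈ G.edges with k ∈ e ∧ j ∈ e, ∏ l ∈ e, x l
      ≤ ∑ e ∈ G.edges with k ∈ e ∧ i ∈ e, ∏ l ∈ e, x l := by
  have hnn : ∀ e ∈ G.edges, ∀ l ∈ e, 0 ≤ x l := fun e he l hl =>
    (hpos l ((mem_powersetCard.1 (G.edges_subset he)).1 hl)).le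
  rw [← sum_filter_add_sum_filter_not {e ∈ G.edges | k ∈ e ∧ j ∈ e} (i ∈ ·),
    ← sum_filter_add_sum_filter_not {e ∈ G.edges | k ∈ e ∧ i ∈ e} (j ∈ ·)]
  simp only [filter_filter]
  -- Edges through i, j and k count on both sides; in the others j is replaced by i.
  refine add_le_add (le_of_eq (sum_congr (filter_congr fun e _ => by tauto) fun _ _ => rfl)) ?_
  have inj : Set.InjOn (fun e : Finset ℕ => insert i (e.erase j))
      ({e ∈ G.edges | (k ∈ e ∧ j ∈ e) ∧ i ∉ e} : Finset (Finset ℕ)) := by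
    intro e he f hf h
    have he := (mem_filter.1 he).2
    have hf := (mem_filter.1 hf).2
    have h' : (insert i (e.erase j)).erase i = (insert i (f.erase j)).erase i := by
      simp only at h; rw [h]
    rw [erase_insert (by simp [he.2]), erase_insert (by simp [hf.2])] at h'
    rw [← insert_erase he.1.2, ← insert_erase hf.1.2, h']
  calc _ ≤ ∑ e ∈ G.edges with (k ∈ e ∧ j ∈ e) ∧ i ∉ e, ∏ l ∈ insert i (e.erase j), x l := by
        refine sum_le_sum fun e he => ?_
        obtain ⟨he, h⟩ := mem_filter.1 he
        rw [prod_insert (by simp [h.2]), ← mul_prod_erase _ _ h.1.2]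
        exact mul_le_mul_of_nonneg_right hx
          (prod_nonneg fun l hl => hnn e he l (mem_of_mem_erase hl))
    _ = ∑ e ∈ {e ∈ G.edges | (k ∈ e ∧ j ∈ e) ∧ i ∉ e}.image fun e => insert i (e.erase j),
          ∏ l ∈ e, x l :=
        (sum_image (f := fun e => ∏ l ∈ e, x l) inj).symm
    _ ≤ _ := by
        refine sum_le_sum_of_subset_of_nonneg ?_ fun e he _ =>
          prod_nonneg (hnn e (mem_filter.1 he).1)
        intro f hf
        obtain ⟨e, he, rfl⟩ := mem_image.1 hf
        obtain ⟨he, h⟩ := mem_filter.1 he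
        refine mem_filter.2 ⟨hG i j hi hij hj _ (by simp [h.2]) (by simp) ?_, ?_⟩
        · rwa [insert_erase h.1.2]
        · simp [h.1.1, hki, hkj, hij.ne']

theorem RGraph.LeftCompressed.mul_pairLink_le {r n : ℕ} {G : RGraph r n} (hG : G.LeftCompressed)
    {x : ℕ → ℝ} (hpos : ∀ k ∈ Icc 1 n, 0 < x k) {i j k : ℕ} (hi : 1 ≤ i) (hij : i < j)
    (hj : j ≤ n) (hki : k ≠ i) (hkj : k ≠ j) (hx : x j ≤ x i) (hk : k ∈ Icc 1 n) :
    x j * edgeSum (pairLink G.edges k j) x ≤ x i * edgeSum (pairLink G.edges i k) x := by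
  have h := hG.pair_le hpos hi hij hj hki hkj hx
  have hsw : ∑ e ∈ G.edges with k ∈ e ∧ i ∈ e, ∏ l ∈ e, x l
      = ∑ e ∈ G.edges with i ∈ e ∧ k ∈ e, ∏ l ∈ e, x l :=
    sum_congr (filter_congr fun e _ => and_comm) fun _ _ => rfl
  rw [hsw, sum_pairLink _ _ hkj, sum_pairLink _ _ hki.symm] at h
  refine le_of_mul_le_mul_left ?_ (hpos k hk)
  linarith

/-! ### The possible non-edges -/

/-- The `a` colex-largest subsets of `[t]` of size `t - p + 1`, when `a ≤ p`. -/
def colexTop (p t a : ℕ) : Finset (Finset ℕ) :=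
  (Icc (p + 1 - a) p).image (insert · (Icc (p + 1) t))

/-- Replacing an element of a member of `F` by a larger element of `[t]` stays in `F`. -/
def ShiftClosed (t : ℕ) (F : Finset (Finset ℕ)) : Prop :=
  ∀ i j : ℕ, 1 ≤ i → i < j → j ≤ t → ∀ A : Finset ℕ, i ∉ A → j ∉ A →
    insert i A ∈ F → insert j A ∈ F

theorem insert_Icc_injOn (p t : ℕ) :
    Set.InjOn (insert · (Icc (p + 1) t)) (Set.Iic p) := by
  intro i hi j hj h
  have h1 : i ∈ insert j (Icc (p + 1) t) := by
    have := mem_insert_self i (Icc (p + 1) t)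
    simp only at h
    rwa [h] at this
  simp only [mem_insert, mem_Icc, Set.mem_Iic] at h1 hi
  omega

theorem card_colexTop {p t a : ℕ} (ha : a ≤ p) : #(colexTop p t a) = a := by
  rw [colexTop, card_image_of_injOn, Nat.card_Icc]
  · omega
  · exact (insert_Icc_injOn p t).mono fun i hi => by simp at hi ⊢; omega

theorem mem_colexTop {p t a : ℕ} {B : Finset ℕ} :
    B ∈ colexTop p t a ↔ ∃ k, p + 1 - a ≤ k ∧ k ≤ p ∧ insert k (Icc (p + 1) t) = B := by
  simp [colexTop, and_assoc]

theorem colexTop_subset {r p t a : ℕ} (ht : t + 1 = p + r) (ha : a ≤ p) (hr : 1 ≤ r) :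
    colexTop p t a ⊆ (Icc 1 t).powersetCard r := by
  intro B hB
  obtain ⟨k, hk1, hk2, rfl⟩ := mem_colexTop.1 hB
  rw [mem_powersetCard, card_insert_of_notMem (by simp; omega), Nat.card_Icc]
  refine ⟨fun i hi => ?_, by omega⟩
  simp only [mem_insert, mem_Icc] at hi ⊢
  omega

section
variable {r p t a : ℕ} {F : Finset (Finset ℕ)}

/-- If {k} ∪ T is in F, shifting puts {j} ∪ T in F for all k ≤ j ≤ p, and there is room for only a
of these. -/
theorem mem_colexTop_of_subset (hr : 1 ≤ r) (ht : t + 1 = p + r)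
    (hF : F ⊆ (Icc 1 t).powersetCard r) (hup : ShiftClosed t F) (hcard : #F = a)
    {B : Finset ℕ} (hB : B ∈ F) (hT : Icc (p + 1) t ⊆ B) : B ∈ colexTop p t a := by
  obtain ⟨hB1, hB2⟩ := mem_powersetCard.1 (hF hB)
  have h1 : #(B \ Icc (p + 1) t) = 1 := by
    rw [card_sdiff_of_subset hT, hB2, Nat.card_Icc]
    omega
  obtain ⟨k, hk⟩ := card_eq_one.1 h1
  have hkB : k ∈ B \ Icc (p + 1) t := by rw [hk]; simp
  rw [mem_sdiff] at hkB
  have hk1 := mem_Icc.1 (hB1 hkB.1)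
  have hkp : k ≤ p := by
    have := hkB.2; rw [mem_Icc] at this; omega
  have hBk : insert k (Icc (p + 1) t) = B := by
    rw [← sdiff_union_of_subset hT, hk]; rfl
  refine mem_colexTop.2 ⟨k, ?_, hkp, hBk⟩
  have hsub : (Icc k p).image (insert · (Icc (p + 1) t)) ⊆ F := by
    intro A hA
    obtain ⟨j, hj, rfl⟩ := mem_image.1 hA
    rw [mem_Icc] at hj
    rcases hj.1.eq_or_lt with rfl | hlt
    · exact hBk ▸ hB
    · refine hup k j hk1.1 hlt ?_ _ (by simp; omega) (by simp; omega) (hBk ▸ hB)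
      by_contra! h
      omega
  have := card_le_card hsub
  rw [card_image_of_injOn ((insert_Icc_injOn p t).mono fun i hi => by simp at hi ⊢; omega),
    Nat.card_Icc, hcard] at this
  omega

theorem eq_of_mem_sdiff_colexTop (hr : 4 ≤ r) (hp : 3 < p) (ht : t + 1 = p + r)
    (hF : F ⊆ (Icc 1 t).powersetCard r) (hup : ShiftClosed t F) (hcard : #F = a)
    (hU : #(F \ colexTop p t a) ≤ 2) {B : Finset ℕ} (hB : B ∈ F \ colexTop p t a) :
    B = insert (p - 1) (insert p (Icc (p + 2) t)) ∨ B = insert (p - 2) (insert p (Icc (p + 2) t)) ∨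
      B = insert (p - 1) (insert p (insert (p + 1) (Icc (p + 3) t))) := by
  obtain ⟨hBF, hBT⟩ := mem_sdiff.1 hB
  obtain ⟨hB1, hB2⟩ := mem_powersetCard.1 (hF hBF)
  -- upward replacements that still miss part of `T` stay outside `colexTop`
  have hshift : ∀ i j k, i ∈ B → j ∉ B → i < j → j ≤ t → p < k → k ≤ t →
      k ∉ insert j (B.erase i) → insert j (B.erase i) ∈ F \ colexTop p t a := by
    intro i j k hi hj hij hjt hk hkt hkB
    refine mem_sdiff.2 ⟨hup i j (mem_Icc.1 (hB1 hi)).1 hij hjt _ (notMem_erase _ _)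
      (fun h => hj (mem_of_mem_erase h)) (by rwa [insert_erase hi]), fun h => hkB ?_⟩
    obtain ⟨l, -, -, hl⟩ := mem_colexTop.1 h
    rw [← hl]
    exact mem_insert_of_mem (mem_Icc.2 ⟨hk, hkt⟩)
  -- B and two different shifts of it would be three members outside `colexTop`; so at most one
  -- upward shift leaves part of T uncovered. Each claim below exhibits two such shifts in the case
  -- to be excluded.
  have huniq : ∀ i j k i' j' k', i ∈ B → j ∉ B → i < j → j ≤ t → p < k → k ≤ t →
      k ∉ insert j (B.erase i) → i' ∈ B → j' ∉ B → i' < j' → j' ≤ t → p < k' → k' ≤ t →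
      k' ∉ insert j' (B.erase i') → i = i' ∧ j = j' := by
    intro i j k i' j' k' hi hj hij hjt hk hkt hkB hi' hj' hij' hjt' hk' hkt' hkB'
    have h1 := hshift i j k hi hj hij hjt hk hkt hkB
    have h2 := hshift i' j' k' hi' hj' hij' hjt' hk' hkt' hkB'
    have hne : ∀ i j, i ∈ B → j ∉ B → B ≠ insert j (B.erase i) := by
      intro i j hi hj h
      exact hj (by rw [h]; exact mem_insert_self _ _)
    have heq : insert j (B.erase i) = insert j' (B.erase i') := by
      by_contra hne'
      have : 3 ≤ #(F \ colexTop p t a) := by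
        rw [← card_eq_three.2 ⟨B, _, _, hne i j hi hj, hne i' j' hi' hj', hne', rfl⟩]
        refine card_le_card ?_
        intro X hX
        simp only [mem_insert, mem_singleton] at hX
        rcases hX with rfl | rfl | rfl <;> assumption
      omega
    have hjj : j ∈ insert j' (B.erase i') := heq ▸ mem_insert_self _ _
    have hii : i ∉ insert j' (B.erase i') := by
      rw [← heq]; simp only [mem_insert, mem_erase]; rintro (h | h)
      · omega
      · exact h.1 rfl
    constructor
    · by_contra hne
      exact hii (mem_insert_of_mem (mem_erase.2 ⟨hne, hi⟩))
    · rcases mem_insert.1 hjj with h | h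
      · exact h
      · exact absurd (mem_of_mem_erase h) hj
  set T := Icc (p + 1) t with hT
  have hTcard : #T = r - 1 := by rw [hT, Nat.card_Icc]; omega
  have hTB : ¬ T ⊆ B := fun h => hBT (mem_colexTop_of_subset (by omega) ht hF hup hcard hBF h)
  have hmT : ∀ {k}, k ∈ T ↔ p < k ∧ k ≤ t := by intro k; rw [hT, mem_Icc]; omega
  have hcards : #(B \ T) + #(B ∩ T) = r := by rw [← hB2]; exact card_sdiff_add_card_inter B T
  have hcards' : #(T \ B) + #(B ∩ T) = r - 1 := by
    rw [← hTcard, inter_comm]; exact card_sdiff_add_card_inter T B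
  have hpos : 1 ≤ #(T \ B) := card_pos.2 (sdiff_nonempty.2 hTB)
  have hlow : ∀ {k}, k ∈ B \ T → k ∈ B ∧ 1 ≤ k ∧ k ≤ p := by
    intro k hk
    rw [mem_sdiff, hmT] at hk
    have := mem_Icc.1 (hB1 hk.1)
    exact ⟨hk.1, this.1, by omega⟩
  have hone : #(T \ B) = 1 := by
    by_contra hne
    obtain ⟨q, hq, q', hq', hqq⟩ := one_lt_card.1 (show 1 < #(T \ B) by omega)
    obtain ⟨i, hi⟩ := card_pos.1 (show 0 < #(B \ T) by omega)
    rw [mem_sdiff, hmT] at hq hq'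
    obtain ⟨hiB, -, hip⟩ := hlow hi
    exact hqq (huniq i q q' i q' q hiB hq.2 (by omega) hq.1.2 hq'.1.1 hq'.1.2
      (by simp [hq'.2, hqq.symm]) hiB hq'.2 (by omega) hq'.1.2 hq.1.1 hq.1.2
      (by simp [hq.2, hqq])).2
  obtain ⟨q, hq⟩ := card_eq_one.1 hone
  have hqT : q ∈ T \ B := by rw [hq]; simp
  rw [mem_sdiff, hmT] at hqT
  obtain ⟨⟨hpq, hqt⟩, hqB⟩ := hqT
  have hTB' : ∀ k, p < k → k ≤ t → k ≠ q → k ∈ B := by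
    intro k h1 h2 h3
    by_contra h
    have : k ∈ T \ B := mem_sdiff.2 ⟨hmT.2 ⟨h1, h2⟩, h⟩
    rw [hq] at this
    exact h3 (mem_singleton.1 this)
  obtain ⟨i₁, i₂, hlt, hBT2⟩ : ∃ i₁ i₂, i₁ < i₂ ∧ B \ T = {i₁, i₂} := by
    obtain ⟨x, y, hxy, h⟩ := card_eq_two.1 (show #(B \ T) = 2 by omega)
    rcases lt_or_gt_of_ne hxy with h' | h'
    · exact ⟨x, y, h', h⟩
    · exact ⟨y, x, h', by rw [h, pair_comm]⟩
  obtain ⟨hi₁, hi₁1, hi₁p⟩ := hlow (k := i₁) (by rw [hBT2]; simp)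
  obtain ⟨hi₂, hi₂1, hi₂p⟩ := hlow (k := i₂) (by rw [hBT2]; simp)
  have hnot : ∀ k, k ≤ p → k ≠ i₁ → k ≠ i₂ → k ∉ B := by
    intro k hk h1 h2 h
    have : k ∈ B \ T := mem_sdiff.2 ⟨h, by rw [hmT]; omega⟩
    rw [hBT2] at this
    simp [h1, h2] at this
  have hq' : ∀ i j, j ≤ p → q ∉ insert j (B.erase i) := by
    intro i j hj
    simp only [mem_insert, mem_erase, not_or]
    exact ⟨by omega, fun h => hqB h.2⟩
  have hself : ∀ i j, i < j → i ∉ insert j (B.erase i) := by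
    intro i j hj
    simp only [mem_insert, mem_erase, not_or]
    exact ⟨by omega, fun h => h.1 rfl⟩
  have hi₂eq : i₂ = p := by
    by_contra hne
    have hpB := hnot p le_rfl (by omega) (by omega)
    have := (huniq i₁ p q i₂ p q hi₁ hpB (by omega) (by omega) hpq hqt (hq' _ _ le_rfl)
      hi₂ hpB (by omega) (by omega) hpq hqt (hq' _ _ le_rfl)).1
    omega
  have hi₁ge : p ≤ i₁ + 2 := by
    by_contra! hlt
    have := (huniq i₁ (p - 1) q i₁ (p - 2) q hi₁ (hnot _ (by omega) (by omega) (by omega))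
      (by omega) (by omega) hpq hqt (hq' _ _ (by omega)) hi₁
      (hnot _ (by omega) (by omega) (by omega))
      (by omega) (by omega) hpq hqt (hq' _ _ (by omega))).2
    omega
  have hqle : q ≤ p + 2 := by
    by_contra! hlt
    have := (huniq (p + 1) q (p + 1) (p + 2) q (p + 2)
      (hTB' _ (by omega) (by omega) (by omega)) hqB (by omega) hqt (by omega) (by omega)
      (hself _ _ (by omega)) (hTB' _ (by omega) (by omega) (by omega)) hqB (by omega) hqt
      (by omega) (by omega) (hself _ _ (by omega))).1
    omega
  have hnboth : ¬ (i₁ + 2 = p ∧ q = p + 2) := by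
    rintro ⟨h1, h2⟩
    have := (huniq i₁ (p - 1) q (p + 1) q (p + 1) hi₁ (hnot _ (by omega) (by omega) (by omega))
      (by omega) (by omega) hpq hqt (hq' _ _ (by omega))
      (hTB' _ (by omega) (by omega) (by omega)) hqB (by omega) hqt (by omega) (by omega)
      (hself _ _ (by omega))).1
    omega
  have hmem : ∀ k, k ∈ B ↔ k = i₁ ∨ k = p ∨ (p < k ∧ k ≤ t ∧ k ≠ q) := by
    intro k
    constructor
    · intro h
      by_cases hk : k ≤ p
      · by_contra! h'
        exact hnot k hk h'.1 (by omega) h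
      · exact Or.inr (Or.inr ⟨by omega, (mem_Icc.1 (hB1 h)).2, fun h' => hqB (h' ▸ h)⟩)
    · rintro (rfl | rfl | h)
      · exact hi₁
      · exact hi₂eq ▸ hi₂
      · exact hTB' k h.1 h.2.1 h.2.2
  have : (i₁ = p - 1 ∧ q = p + 1) ∨ (i₁ = p - 2 ∧ q = p + 1) ∨ (i₁ = p - 1 ∧ q = p + 2) := by omega
  rcases this with ⟨rfl, rfl⟩ | ⟨rfl, rfl⟩ | ⟨rfl, rfl⟩
  · left
    ext k
    simp only [hmem, mem_insert, mem_Icc]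
    omega
  · right; left
    ext k
    simp only [hmem, mem_insert, mem_Icc]
    omega
  · right; right
    ext k
    simp only [hmem, mem_insert, mem_Icc]
    omega

end

theorem prod_Icc_eq_mul {x : ℕ → ℝ} {b c : ℕ} (h : b ≤ c) :
    ∏ k ∈ Icc b c, x k = x b * ∏ k ∈ Icc (b + 1) c, x k := by
  rw [← prod_insert (by simp)]
  congr 1
  ext k
  simp only [mem_insert, mem_Icc]
  omega

section
variable {r p t a : ℕ} {F : Finset (Finset ℕ)}

theorem forms_of_mem (hr : 4 ≤ r) (hp : 3 < p) (ht : t + 1 = p + r)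
    (hF : F ⊆ (Icc 1 t).powersetCard r) (hup : ShiftClosed t F) (hcard : #F = a)
    (hU : #(F \ colexTop p t a) ≤ 2) {B : Finset ℕ} (hB : B ∈ F) :
    (∃ k, p + 1 - a ≤ k ∧ k ≤ p ∧ insert k (Icc (p + 1) t) = B) ∨
    B = insert (p - 1) (insert p (Icc (p + 2) t)) ∨ B = insert (p - 2) (insert p (Icc (p + 2) t)) ∨
      B = insert (p - 1) (insert p (insert (p + 1) (Icc (p + 3) t))) := by
  by_cases h : B ∈ colexTop p t a
  · exact Or.inl (mem_colexTop.1 h)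
  · exact Or.inr (eq_of_mem_sdiff_colexTop hr hp ht hF hup hcard hU (mem_sdiff.2 ⟨hB, h⟩))

/-- None of the possible forms has more than two vertices in [p]. This and `not_two_low` certify
that given r-sets are edges of G. -/
theorem not_three_low (hr : 4 ≤ r) (hp : 3 < p) (ht : t + 1 = p + r)
    (hF : F ⊆ (Icc 1 t).powersetCard r) (hup : ShiftClosed t F) (hcard : #F = a)
    (hU : #(F \ colexTop p t a) ≤ 2) {B : Finset ℕ} {i j k : ℕ} (hi : i ∈ B) (hj : j ∈ B)
    (hk : k ∈ B) (hij : i < j) (hjk : j < k) (hkp : k ≤ p) : B ∉ F := by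
  intro hB
  rcases forms_of_mem hr hp ht hF hup hcard hU hB with ⟨l, -, hl, rfl⟩ | rfl | rfl | rfl <;>
  · simp only [mem_insert, mem_Icc] at hi hj hk
    omega

theorem not_two_low (hr : 4 ≤ r) (hp : 3 < p) (ht : t + 1 = p + r)
    (hF : F ⊆ (Icc 1 t).powersetCard r) (hup : ShiftClosed t F) (hcard : #F = a)
    (hU : #(F \ colexTop p t a) ≤ 2) {B : Finset ℕ} {i j : ℕ} (hi : i ∈ B) (hj : j ∈ B)
    (hij : i < j) (hjp : j + 3 ≤ p) : B ∉ F := by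
  intro hB
  rcases forms_of_mem hr hp ht hF hup hcard hU hB with ⟨l, -, hl, rfl⟩ | rfl | rfl | rfl <;>
  · simp only [mem_insert, mem_Icc] at hi hj
    omega

end

/-! ### Estimates for pair links and link differences -/

section
variable {r p t a : ℕ} {E : Finset (Finset ℕ)} {x : ℕ → ℝ}

theorem insert_mem_compl (hE : E ⊆ (Icc 1 t).powersetCard r) {i j : ℕ} (hij : i ≠ j)
    (hj : j ∈ Icc 1 t) {A : Finset ℕ} (hA : A ∈ linkAvoiding E i j \ linkAvoiding E j i) :
    i ∉ A ∧ j ∉ A ∧ insert j A ∈ (Icc 1 t).powersetCard r \ E := by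
  rw [mem_sdiff, mem_linkAvoiding hij, mem_linkAvoiding hij.symm] at hA
  obtain ⟨⟨h1, h2, h3⟩, h4⟩ := hA
  obtain ⟨h5, h6⟩ := mem_powersetCard.1 (hE h3)
  refine ⟨h1, h2, mem_sdiff.2 ⟨mem_powersetCard.2 ⟨?_, ?_⟩, fun h => h4 ⟨h2, h1, h⟩⟩⟩
  · exact insert_subset hj ((subset_insert _ _).trans h5)
  · rw [card_insert_of_notMem h2, ← h6, card_insert_of_notMem h1]

/-- A ↦ A ∪ {j} embeds the link difference into the non-edges through j, all of which lie in S. -/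
theorem edgeSum_linkDiff_le (hE : E ⊆ (Icc 1 t).powersetCard r) {i j : ℕ} (hij : i ≠ j)
    (hj : j ∈ Icc 1 t) {S : Finset (Finset ℕ)} {c : ℝ} (hc : 0 ≤ c)
    (hS : ∀ f ∈ (Icc 1 t).powersetCard r \ E, j ∈ f → f ∈ S)
    (hb : ∀ A, i ∉ A → j ∉ A → insert j A ∈ (Icc 1 t).powersetCard r \ E → ∏ k ∈ A, x k ≤ c) :
    edgeSum (linkAvoiding E i j \ linkAvoiding E j i) x ≤ #S * c := by
  calc _ ≤ #(linkAvoiding E i j \ linkAvoiding E j i) • c := by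
        refine sum_le_card_nsmul _ _ _ fun A hA => ?_
        obtain ⟨h1, h2, h3⟩ := insert_mem_compl hE hij hj hA
        exact hb A h1 h2 h3
    _ ≤ #S • c := by
        refine nsmul_le_nsmul_left hc ?_
        refine card_le_card_of_injOn (insert j) ?_ ?_
        · intro A hA
          exact hS _ (insert_mem_compl hE hij hj hA).2.2 (mem_insert_self _ _)
        · intro A hA A' hA' h
          rw [← erase_insert (insert_mem_compl hE hij hj hA).2.1, h,
            erase_insert (insert_mem_compl hE hij hj hA').2.1]
    _ = _ := nsmul_eq_mul _ _

/-- Two vertices of [4] other than i and j are at most p - 3, so any r-set containing them together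
with i and j is an edge. -/
theorem pairLink_pos (hr : 4 ≤ r) (hp : 6 < p) (ht : t + 1 = p + r)
    (hup : ShiftClosed t ((Icc 1 t).powersetCard r \ E))
    (hcard : #((Icc 1 t).powersetCard r \ E) = a)
    (hU : #(((Icc 1 t).powersetCard r \ E) \ colexTop p t a) ≤ 2)
    (hE : E ⊆ (Icc 1 t).powersetCard r)
    (hpos : ∀ k ∈ Icc 1 t, 0 < x k) {i j : ℕ} (hi : 1 ≤ i) (hij : i < j) (hj : j ≤ t) :
    0 < edgeSum (pairLink E i j) x := by
  have hnn : ∀ B ∈ pairLink E i j, ∀ k ∈ B, k ∈ Icc 1 t := by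
    intro B hB k hk
    have h := (mem_pairLink hij.ne).1 hB
    exact (mem_powersetCard.1 (hE h.2.2)).1 (by simp [hk])
  refine sum_pos (fun B hB => prod_pos fun k hk => hpos k (hnn B hB k hk)) ?_
  obtain ⟨k, l, hk, hkl, hl, h1, h2, h3, h4⟩ : ∃ k l, 1 ≤ k ∧ k < l ∧ l ≤ 4 ∧ k ≠ i ∧ k ≠ j ∧
      l ≠ i ∧ l ≠ j := by
    by_cases h12 : i ≤ 2
    · by_cases h3 : j ≤ 2
      · exact ⟨3, 4, by omega⟩
      · by_cases h4 : j = 3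
        · exact ⟨3 - i, 4, by omega⟩
        · exact ⟨3 - i, 3, by omega⟩
    · exact ⟨1, 2, by omega⟩
  obtain ⟨e, he1, he2, he3⟩ := exists_subsuperset_card_eq (s := {i, j, k, l}) (t := Icc 1 t)
    (n := r) (by intro m hm; simp only [mem_insert, mem_singleton, mem_Icc] at hm ⊢; omega)
    (card_le_four.trans hr) (by rw [Nat.card_Icc]; omega)
  have heE : e ∈ E := by
    by_contra h
    exact not_two_low hr (by omega) ht sdiff_subset hup hcard hU (he1 (by simp)) (he1 (by simp))
      hkl (by omega) (mem_sdiff.2 ⟨mem_powersetCard.2 ⟨he2, he3⟩, h⟩)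
  exact ⟨(e.erase i).erase j, mem_image_of_mem _
    (mem_filter.2 ⟨heE, he1 (by simp), he1 (by simp)⟩)⟩

/-- For 2 ≤ k < l ≤ p the r-set {1, k, l, p+2} ∪ [p+4, t] has three vertices in [p], hence is an
edge; {k, l} can be chosen in C(p-1, 2) ways. -/
theorem pairLink_one_ge (hr : 4 ≤ r) (hp : 6 < p) (ht : t + 1 = p + r)
    (hup : ShiftClosed t ((Icc 1 t).powersetCard r \ E))
    (hcard : #((Icc 1 t).powersetCard r \ E) = a)
    (hU : #(((Icc 1 t).powersetCard r \ E) \ colexTop p t a) ≤ 2)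
    (hE : E ⊆ (Icc 1 t).powersetCard r)
    (hpos : ∀ k ∈ Icc 1 t, 0 < x k) (hanti : ∀ i j, 1 ≤ i → i ≤ j → j ≤ t → x j ≤ x i) :
    ((p - 1).choose 2 : ℝ) * (x p ^ 2 * ∏ k ∈ Icc (p + 4) t, x k)
      ≤ edgeSum (pairLink E 1 (p + 2)) x := by
  have hne : (1 : ℕ) ≠ p + 2 := by omega
  have hnn : ∀ B ∈ pairLink E 1 (p + 2), ∀ k ∈ B, k ∈ Icc 1 t := by
    intro B hB k hk
    have h := (mem_pairLink hne).1 hB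
    exact (mem_powersetCard.1 (hE h.2.2)).1 (by simp [hk])
  have hdisj : ∀ K ∈ (Icc 2 p).powersetCard 2, Disjoint K (Icc (p + 4) t) := by
    intro K hK
    refine disjoint_left.2 fun k hk hk' => ?_
    have := mem_Icc.1 ((mem_powersetCard.1 hK).1 hk)
    have := mem_Icc.1 hk'
    omega
  have hinj : Set.InjOn (· ∪ Icc (p + 4) t) ((Icc 2 p).powersetCard 2 : Finset (Finset ℕ)) := by
    intro K hK K' hK' h
    simp only at h
    rw [← union_sdiff_cancel_right (hdisj K hK), h, union_sdiff_cancel_right (hdisj K' hK')]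
  have hp0 : 0 ≤ x p := (hpos p (by simp; omega)).le
  have hR0 : 0 ≤ ∏ k ∈ Icc (p + 4) t, x k :=
    prod_nonneg fun k hk => (hpos k (by simp at hk ⊢; omega)).le
  calc ((p - 1).choose 2 : ℝ) * (x p ^ 2 * ∏ k ∈ Icc (p + 4) t, x k)
      = #((Icc 2 p).powersetCard 2) • (x p ^ 2 * ∏ k ∈ Icc (p + 4) t, x k) := by
        rw [nsmul_eq_mul, card_powersetCard, Nat.card_Icc, show p + 1 - 2 = p - 1 by omega]
    _ ≤ ∑ K ∈ (Icc 2 p).powersetCard 2, ∏ k ∈ K ∪ Icc (p + 4) t, x k := by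
        refine card_nsmul_le_sum _ _ _ fun K hK => ?_
        rw [prod_union (hdisj K hK)]
        refine mul_le_mul_of_nonneg_right ?_ hR0
        obtain ⟨hK1, hK2⟩ := mem_powersetCard.1 hK
        rw [← hK2, ← prod_const]
        refine prod_le_prod (fun _ _ => hp0) fun k hk => ?_
        have := mem_Icc.1 (hK1 hk)
        exact hanti k p (by omega) (by omega) (by omega)
    _ = ∑ B ∈ ((Icc 2 p).powersetCard 2).image (· ∪ Icc (p + 4) t), ∏ k ∈ B, x k :=
        (sum_image (f := fun B => ∏ k ∈ B, x k) hinj).symm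
    _ ≤ _ := by
        refine sum_le_sum_of_subset_of_nonneg ?_ fun B hB _ =>
          prod_nonneg fun k hk => (hpos k (hnn B hB k hk)).le
        intro B hB
        obtain ⟨K, hK, rfl⟩ := mem_image.1 hB
        obtain ⟨hK1, hK2⟩ := mem_powersetCard.1 hK
        have hK3 : ∀ k ∈ K, 2 ≤ k ∧ k ≤ p := fun k hk => mem_Icc.1 (hK1 hk)
        have n1 : 1 ∉ K ∪ Icc (p + 4) t := by
          rw [mem_union, mem_Icc, not_or]
          exact ⟨fun h => by have := hK3 _ h; omega, by omega⟩
        have n2 : p + 2 ∉ K ∪ Icc (p + 4) t := by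
          rw [mem_union, mem_Icc, not_or]
          exact ⟨fun h => by have := hK3 _ h; omega, by omega⟩
        refine (mem_pairLink hne).2 ⟨n1, n2, ?_⟩
        by_contra h
        obtain ⟨k, l, hkl, rfl⟩ : ∃ k l, k < l ∧ K = {k, l} := by
          obtain ⟨y, z, hyz, h⟩ := card_eq_two.1 hK2
          rcases lt_or_gt_of_ne hyz with h' | h'
          · exact ⟨y, z, h', h⟩
          · exact ⟨z, y, h', by rw [h, pair_comm]⟩
        have hk := hK3 k (by simp)
        have hl := hK3 l (by simp)
        refine not_three_low hr (by omega) ht sdiff_subset hup hcard hU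
          (i := 1) (j := k) (k := l) (by simp) (by simp) (by simp) (by omega) hkl (by omega)
          (mem_sdiff.2 ⟨mem_powersetCard.2 ⟨?_, ?_⟩, h⟩)
        · intro m hm
          simp only [mem_insert, mem_union, mem_singleton, mem_Icc] at hm ⊢
          omega
        · rw [card_insert_of_notMem (by rw [mem_insert, not_or]; exact ⟨hne, n1⟩),
            card_insert_of_notMem n2, card_union_of_disjoint (hdisj _ hK), hK2, Nat.card_Icc]
          omega

/-- Lower bound for the defect between `p` and `p + 1`. -/
theorem linkDiff_ge (hr : 4 ≤ r) (hp : 6 < p) (ht : t + 1 = p + r) (hap : a ≤ p)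
    (hcard : #((Icc 1 t).powersetCard r \ E) = a)
    (hU : #(((Icc 1 t).powersetCard r \ E) \ colexTop p t a) ≤ 2)
    (hE : E ⊆ (Icc 1 t).powersetCard r)
    (hpos : ∀ k ∈ Icc 1 t, 0 < x k) (hanti : ∀ i j, 1 ≤ i → i ≤ j → j ≤ t → x j ≤ x i) :
    ((a : ℝ) - 5) * (x p * ∏ k ∈ Icc (p + 2) t, x k)
      ≤ edgeSum (linkAvoiding E p (p + 1) \ linkAvoiding E (p + 1) p) x := by
  set F := (Icc 1 t).powersetCard r \ E
  have hne : p ≠ p + 1 := by omega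
  -- For k in I, the set {k} ∪ [p+2, t] extends to an edge by p but not by p+1. Of the a - 1
  -- candidates, `I₁` and `I₂` exclude at most two each, which leaves a - 5.
  set I := {k ∈ Icc (p + 1 - a) (p - 1) | insert k (Icc (p + 1) t) ∈ F ∧
    insert p (insert k (Icc (p + 2) t)) ∉ F} with hI
  set I₁ := {k ∈ Icc (p + 1 - a) (p - 1) | insert k (Icc (p + 1) t) ∉ F} with hI₁
  set I₂ := {k ∈ Icc (p + 1 - a) (p - 1) | insert p (insert k (Icc (p + 2) t)) ∈ F} with hI₂
  have hinj : Set.InjOn (fun k => insert k (Icc (p + 2) t)) (Set.Iic (p + 1)) :=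
    insert_Icc_injOn (p + 1) t
  have h1 : #I₁ ≤ 2 := by
    refine le_trans ?_ hU
    rw [← card_sdiff_comm (hcard.trans (card_colexTop hap).symm).symm]
    refine card_le_card_of_injOn (insert · (Icc (p + 1) t)) ?_ ?_
    · intro k hk
      obtain ⟨hk1, hk2⟩ := mem_filter.1 hk
      rw [mem_Icc] at hk1
      exact mem_sdiff.2 ⟨mem_colexTop.2 ⟨k, hk1.1, by omega, rfl⟩, hk2⟩
    · refine (insert_Icc_injOn p t).mono fun k hk => ?_
      have := mem_Icc.1 (mem_filter.1 hk).1
      simp only [Set.mem_Iic]; omega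
  have h2 : #I₂ ≤ 2 := by
    refine le_trans ?_ hU
    refine card_le_card_of_injOn (fun k => insert p (insert k (Icc (p + 2) t))) ?_ ?_
    · intro k hk
      obtain ⟨hk1, hk2⟩ := mem_filter.1 hk
      rw [mem_Icc] at hk1
      refine mem_sdiff.2 ⟨hk2, fun h => ?_⟩
      obtain ⟨l, -, hl, h⟩ := mem_colexTop.1 h
      dsimp only at h
      have : p + 1 ∈ insert p (insert k (Icc (p + 2) t)) := by
        rw [← h]; simp; omega
      simp only [mem_insert, mem_Icc] at this
      omega
    · intro k hk l hl h
      have hk := mem_Icc.1 (mem_filter.1 hk).1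
      have hl := mem_Icc.1 (mem_filter.1 hl).1
      have : k ∈ insert p (insert l (Icc (p + 2) t)) := by
        simp only at h; rw [← h]; simp
      simp only [mem_insert, mem_Icc] at this
      omega
  have hIcard : a ≤ #I + 5 := by
    have : Icc (p + 1 - a) (p - 1) ⊆ I ∪ (I₁ ∪ I₂) := by
      intro k hk
      simp only [hI, hI₁, hI₂, mem_union, mem_filter]
      tauto
    have := (card_le_card this).trans (card_union_le _ _)
    have := card_union_le I₁ I₂
    rw [Nat.card_Icc] at *
    omega
  have hQ0 : 0 ≤ x p * ∏ k ∈ Icc (p + 2) t, x k :=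
    mul_nonneg (hpos p (by simp; omega)).le
      (prod_nonneg fun k hk => (hpos k (by simp at hk ⊢; omega)).le)
  calc ((a : ℝ) - 5) * (x p * ∏ k ∈ Icc (p + 2) t, x k)
      ≤ #I • (x p * ∏ k ∈ Icc (p + 2) t, x k) := by
        rw [nsmul_eq_mul]
        refine mul_le_mul_of_nonneg_right ?_ hQ0
        have : (a : ℝ) ≤ #I + 5 := by exact_mod_cast hIcard
        linarith
    _ ≤ ∑ k ∈ I, ∏ l ∈ insert k (Icc (p + 2) t), x l := by
        refine card_nsmul_le_sum _ _ _ fun k hk => ?_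
        have hk := mem_Icc.1 (mem_filter.1 hk).1
        rw [prod_insert (by simp; omega)]
        refine mul_le_mul_of_nonneg_right (hanti k p (by omega) (by omega) (by omega)) ?_
        exact prod_nonneg fun k hk => (hpos k (by simp at hk ⊢; omega)).le
    _ = ∑ A ∈ I.image fun k => insert k (Icc (p + 2) t), ∏ l ∈ A, x l := by
        refine (sum_image (f := fun A => ∏ l ∈ A, x l) (hinj.mono fun k hk => ?_)).symm
        have := mem_Icc.1 (mem_filter.1 hk).1
        simp only [Set.mem_Iic]; omega
    _ ≤ _ := by
        refine sum_le_sum_of_subset_of_nonneg ?_ fun A hA _ => prod_nonneg fun k hk => ?_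
        · intro A hA
          obtain ⟨k, hk, rfl⟩ := mem_image.1 hA
          obtain ⟨hk1, hk2, hk3⟩ := mem_filter.1 hk
          rw [mem_Icc] at hk1
          rw [mem_sdiff, mem_linkAvoiding hne, mem_linkAvoiding hne.symm]
          have hp1 : insert (p + 1) (insert k (Icc (p + 2) t)) = insert k (Icc (p + 1) t) := by
            ext m
            simp only [mem_insert, mem_Icc]
            omega
          refine ⟨⟨by simp; omega, by simp; omega, ?_⟩, fun h => ?_⟩
          · by_contra h
            refine hk3 (mem_sdiff.2 ⟨mem_powersetCard.2 ⟨?_, ?_⟩, h⟩)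
            · intro m hm
              simp only [mem_insert, mem_Icc] at hm ⊢
              omega
            · rw [card_insert_of_notMem (by simp; omega), card_insert_of_notMem (by simp; omega),
                Nat.card_Icc]
              omega
          · rw [hp1] at h
            exact (mem_sdiff.1 hk2).2 h.2.2
        · have h := (mem_linkAvoiding hne).1 (mem_sdiff.1 hA).1
          exact (hpos k ((mem_powersetCard.1 (hE h.2.2)).1 (by simp [hk]))).le

end

/-! ### The inequality x_1 x_{p+1} ≤ x_p² -/

/-- Here u, w, z, y, v stand for the weights of 1, p, p+1, p+2, p+3, and L₁, L₂, L₃ for the pair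
links of (1, p), (p, p+1), (1, p+2). -/
theorem mul_le_sq_of_stationary {u w z y v Q R R' L₁ L₂ L₃ A C : ℝ}
    (hA : 12 ≤ A) (hC : 100 * A ≤ 22 * C) (hw : 0 < w) (hy : 0 < y)
    (hR' : 0 < R') (hv : 0 < v) (huw : w ≤ u) (hwz : z ≤ w) (hzy : y ≤ z) (hyv : v ≤ y)
    (hQ : Q = y * R) (hR : R = v * R') (hL₂ : 0 < L₂) (hL₃ : C * (w ^ 2 * R') ≤ L₃)
    (h₃ : (u - y) * L₃ ≤ A * (u * (w * R))) (h₂ : (A - 5) * (w * Q) ≤ (w - z) * L₂)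
    (h₁ : 0.78 * u ≤ y → 0.78 * ((u - w) * L₁) ≤ 3 * (u * Q)) (h : z * L₂ ≤ u * L₁) :
    u * z ≤ w ^ 2 := by
  have hu : 0 < u := hw.trans_le huw
  have hyu : 0.78 * u ≤ y := by
    have h4 : (u - y) * (C * (w ^ 2 * R')) ≤ A * (u * (w * R)) :=
      (mul_le_mul_of_nonneg_left hL₃ (by linarith)).trans h₃
    have h5 : A * (u * (w * R)) ≤ A * u * (w ^ 2 * R') := by
      rw [hR]
      have : w * (v * R') ≤ w ^ 2 * R' := by
        rw [sq, mul_assoc]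
        gcongr
        linarith
      calc A * (u * (w * (v * R'))) = A * u * (w * (v * R')) := by ring
        _ ≤ _ := mul_le_mul_of_nonneg_left this (by positivity)
    have h6 : (u - y) * C ≤ A * u := by
      have : (u - y) * C * (w ^ 2 * R') ≤ A * u * (w ^ 2 * R') := by linarith
      exact le_of_mul_le_mul_right this (by positivity)
    have h7 : (u - y) * (100 * A) ≤ 22 * (A * u) := by
      have := mul_le_mul_of_nonneg_left hC (show 0 ≤ u - y by linarith)
      linarith
    have h8 : (u - y) * 100 ≤ 22 * u := by
      have : (u - y) * 100 * A ≤ 22 * u * A := by linarith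
      exact le_of_mul_le_mul_right this (by linarith)
    linarith
  have h₁ := h₁ hyu
  by_contra! hcon
  have hQ0 : 0 < Q := by rw [hQ, hR]; positivity
  -- The negated goal w² < uz rearranges to w(w - z) < z(u - w). Chaining it with `h₂`, `h` and `h₁`
  -- gives 0.78 · 7w² < 3u².
  have h4 : w * (w - z) * L₂ < z * (u - w) * L₂ :=
    mul_lt_mul_of_pos_right (by nlinarith) hL₂
  have h5 : w * ((A - 5) * (w * Q)) ≤ w * ((w - z) * L₂) := mul_le_mul_of_nonneg_left h₂ hw.le
  have h6 : (u - w) * (z * L₂) ≤ (u - w) * (u * L₁) := mul_le_mul_of_nonneg_left h (by linarith)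
  have h7 : u * (0.78 * ((u - w) * L₁)) ≤ u * (3 * (u * Q)) := mul_le_mul_of_nonneg_left h₁ hu.le
  have h8 : 7 * (w * (w * Q)) ≤ (A - 5) * (w * (w * Q)) :=
    mul_le_mul_of_nonneg_right (by linarith) (by positivity)
  have h9 : 0.78 * (7 * w ^ 2) * Q < 3 * u ^ 2 * Q := by linarith
  have h10 := lt_of_mul_lt_mul_right h9 hQ0.le
  have h11 : (0.78 * u) ^ 2 ≤ w ^ 2 := by
    have : 0.78 * u ≤ w := by linarith
    gcongr
  -- With w ≥ 0.78u this fails, since 7 · 0.78³ > 3.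
  nlinarith [sq_nonneg u]

/-- Nearly tight at a = p = 12, where it reads 1200 ≤ 22 · 55 = 1210; this is the source of 0.78 = 1
- 0.22. -/
theorem choose_two_bound {a p : ℕ} (ha : 12 ≤ a) (hap : a ≤ p) :
    100 * (a : ℝ) ≤ 22 * ((p - 1).choose 2 : ℝ) := by
  have h1 : (a - 1).choose 2 ≤ (p - 1).choose 2 := Nat.choose_le_choose 2 (by omega)
  have h2 : ((a - 1).choose 2 : ℝ) = ((a : ℝ) - 1) * (a - 2) / 2 := by
    rw [Nat.cast_choose_two, Nat.cast_sub (by omega)]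
    push_cast
    ring
  have h3 : ((a - 1).choose 2 : ℝ) ≤ ((p - 1).choose 2 : ℝ) := by exact_mod_cast h1
  have h4 : (12 : ℝ) ≤ a := by exact_mod_cast ha
  nlinarith

section
variable {r p t a : ℕ} {G : RGraph r t} {x : ℕ → ℝ}

theorem RGraph.LeftCompressed.shiftClosed (hG : G.LeftCompressed) :
    ShiftClosed t ((Icc 1 t).powersetCard r \ G.edges) := by
  intro i j hi hij hj A hiA hjA h
  obtain ⟨h1, h2⟩ := mem_sdiff.1 h
  obtain ⟨h3, h4⟩ := mem_powersetCard.1 h1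
  refine mem_sdiff.2 ⟨mem_powersetCard.2 ⟨?_, ?_⟩, fun h => h2 (hG i j hi hij hj A hiA hjA h)⟩
  · exact insert_subset (mem_Icc.2 ⟨by omega, hj⟩) ((subset_insert _ _).trans h3)
  · rw [← h4, card_insert_of_notMem hiA, card_insert_of_notMem hjA]

theorem antitone_of_isMax (hr : 4 ≤ r) (hp : 6 < p) (ht : t + 1 = p + r) (hG : G.LeftCompressed)
    (hx : x ∈ RGraph.simplex t)
    (hmax : ∀ y ∈ RGraph.simplex t, G.lagrangePoly y ≤ G.lagrangePoly x)
    (hpos : ∀ k ∈ Icc 1 t, 0 < x k)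
    (hcard : #((Icc 1 t).powersetCard r \ G.edges) = a)
    (hU : #(((Icc 1 t).powersetCard r \ G.edges) \ colexTop p t a) ≤ 2) :
    ∀ i j, 1 ≤ i → i ≤ j → j ≤ t → x j ≤ x i := by
  intro i j hi hij hj
  rcases hij.eq_or_lt with rfl | hij
  · exact le_rfl
  have h := hG.stationary hx hmax hpos hi hij hj
  have hL := pairLink_pos hr hp ht hG.shiftClosed hcard hU G.edges_subset hpos hi hij hj
  have h0 : 0 ≤ edgeSum (linkAvoiding G.edges i j \ linkAvoiding G.edges j i) x :=
    edgeSum_nonneg fun A hA k hk => by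
      have h := (mem_linkAvoiding hij.ne).1 (mem_sdiff.1 hA).1
      exact (hpos k ((mem_powersetCard.1 (G.edges_subset h.2.2)).1 (by simp [hk]))).le
  by_contra! hlt
  nlinarith

theorem mul_le_sq_of_isMax (hr : 4 ≤ r) (ha : 12 ≤ a) (hap : a ≤ p) (ht : t + 1 = p + r)
    (hG : G.LeftCompressed) (hx : x ∈ RGraph.simplex t)
    (hmax : ∀ y ∈ RGraph.simplex t, G.lagrangePoly y ≤ G.lagrangePoly x)
    (hpos : ∀ k ∈ Icc 1 t, 0 < x k)
    (hcard : #((Icc 1 t).powersetCard r \ G.edges) = a)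
    (hU : #(((Icc 1 t).powersetCard r \ G.edges) \ colexTop p t a) ≤ 2) :
    x 1 * x (p + 1) ≤ x p ^ 2 := by
  have hp : 6 < p := by omega
  have hanti := antitone_of_isMax hr hp ht hG hx hmax hpos hcard hU
  have hup := hG.shiftClosed
  have hE := G.edges_subset
  have hforms := fun {B} => forms_of_mem (B := B) hr (by omega) ht sdiff_subset hup hcard hU
  have hpos' : ∀ k, 1 ≤ k → k ≤ t → 0 < x k := fun k h1 h2 => hpos k (mem_Icc.2 ⟨h1, h2⟩)
  set R := ∏ k ∈ Icc (p + 3) t, x k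
  have hQ : ∏ k ∈ Icc (p + 2) t, x k = x (p + 2) * R := prod_Icc_eq_mul (by omega)
  have hR : R = x (p + 3) * ∏ k ∈ Icc (p + 4) t, x k := prod_Icc_eq_mul (by omega)
  have hR' : 0 < ∏ k ∈ Icc (p + 4) t, x k :=
    prod_pos fun k hk => hpos k (by simp at hk ⊢; omega)
  have hR0 : 0 < R := hR ▸ mul_pos (hpos' _ (by omega) (by omega)) hR'
  have h1 := hpos' 1 (by omega) (by omega)
  have hp0 := hpos' p (by omega) (by omega)
  have hz0 := hpos' (p + 1) (by omega) (by omega)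
  have hy0 := hpos' (p + 2) (by omega) (by omega)
  refine mul_le_sq_of_stationary (A := a) (C := (p - 1).choose 2) (Q := x (p + 2) * R)
    (R := R) (R' := ∏ k ∈ Icc (p + 4) t, x k) (v := x (p + 3)) (y := x (p + 2))
    (L₁ := edgeSum (pairLink G.edges 1 p) x) (L₂ := edgeSum (pairLink G.edges p (p + 1)) x)
    (L₃ := edgeSum (pairLink G.edges 1 (p + 2)) x) (by exact_mod_cast ha)
    (choose_two_bound ha hap) hp0 hy0 hR' (hpos' _ (by omega) (by omega))
    (hanti _ _ (by omega) (by omega) (by omega)) (hanti _ _ (by omega) (by omega) (by omega))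
    (hanti _ _ (by omega) (by omega) (by omega)) (hanti _ _ (by omega) (by omega) (by omega))
    rfl hR (pairLink_pos hr hp ht hup hcard hU hE hpos (by omega) (by omega) (by omega))
    (pairLink_one_ge hr hp ht hup hcard hU hE hpos hanti) ?_ ?_ ?_ ?_
  · rw [hG.stationary hx hmax hpos le_rfl (by omega) (by omega), ← hcard]
    have hform : ∀ k l, 1 ≤ k → p ≤ l → k < l → l < p + 3 →
        ∏ m ∈ insert k (insert l (Icc (p + 3) t)), x m ≤ x 1 * (x p * R) := by
      intro k l hk hl hkl hlp
      rw [prod_insert (by simp; omega), prod_insert (by simp; omega)]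
      have := hanti 1 k (by omega) (by omega) (by omega)
      have := hanti p l (by omega) (by omega) (by omega)
      have := hpos' l (by omega) (by omega)
      gcongr
    refine edgeSum_linkDiff_le hE (by omega) (mem_Icc.2 ⟨by omega, by omega⟩) (by positivity)
      (fun f hf _ => hf) fun A _ hA hAF => ?_
    have hAe : A = (insert (p + 2) A).erase (p + 2) := (erase_insert hA).symm
    rcases hforms hAF with ⟨k, hk1, hk2, h⟩ | h | h | h
    · convert hform k (p + 1) (by omega) (by omega) (by omega) (by omega) using 2
      rw [hAe, ← h]
      ext m; simp only [mem_erase, mem_insert, mem_Icc]; omega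
    · convert hform (p - 1) p (by omega) (by omega) (by omega) (by omega) using 2
      rw [hAe, h]
      ext m; simp only [mem_erase, mem_insert, mem_Icc]; omega
    · convert hform (p - 2) p (by omega) (by omega) (by omega) (by omega) using 2
      rw [hAe, h]
      ext m; simp only [mem_erase, mem_insert, mem_Icc]; omega
    · have : p + 2 ∈ insert (p + 2) A := mem_insert_self _ _
      rw [h] at this
      simp only [mem_insert, mem_Icc] at this
      omega
  · rw [hG.stationary hx hmax hpos (by omega) (by omega) (by omega), ← hQ]
    exact linkDiff_ge hr hp ht hap hcard hU hE hpos hanti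
  · intro hyu
    rw [hG.stationary hx hmax hpos le_rfl (by omega) (by omega)]
    have hform : ∀ k, 1 ≤ k → k < p + 2 →
        0.78 * ∏ m ∈ insert k (Icc (p + 2) t), x m ≤ x 1 * (x (p + 2) * R) := by
      intro k hk hkp
      rw [prod_insert (by simp; omega), hQ]
      have := hanti 1 k (by omega) (by omega) (by omega)
      have : x k * (x (p + 2) * R) ≤ x 1 * (x (p + 2) * R) := by gcongr
      have : 0 ≤ x k * (x (p + 2) * R) := by
        have := hpos' k (by omega) (by omega)
        positivity
      linarith
    -- Only one member of `colexTop` contains p, so at most three non-edges do.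
    set S := insert (insert p (Icc (p + 1) t))
      (((Icc 1 t).powersetCard r \ G.edges) \ colexTop p t a) with hS
    have hS3 : (#S : ℝ) ≤ 3 := by
      have : #S ≤ 3 := (card_insert_le _ _).trans (by omega)
      exact_mod_cast this
    have hc : 0 ≤ x 1 * (x (p + 2) * R) / 0.78 := by positivity
    have := edgeSum_linkDiff_le (x := x) (i := 1) (j := p) (S := S) hE (by omega)
      (mem_Icc.2 ⟨by omega, by omega⟩) hc ?_ ?_
    · have : (#S : ℝ) * (x 1 * (x (p + 2) * R) / 0.78) ≤ 3 * (x 1 * (x (p + 2) * R) / 0.78) := by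
        gcongr
      have : 0.78 * (x 1 * (x (p + 2) * R) / 0.78) = x 1 * (x (p + 2) * R) :=
        mul_div_cancel₀ _ (by norm_num)
      linarith
    · intro f hf hpf
      by_cases h : f ∈ colexTop p t a
      · obtain ⟨k, -, hk, rfl⟩ := mem_colexTop.1 h
        have : k = p := by
          simp only [mem_insert, mem_Icc] at hpf
          omega
        rw [this]
        exact mem_insert_self _ _
      · exact mem_insert_of_mem (mem_sdiff.2 ⟨hf, h⟩)
    · intro A _ hA hAF
      rw [le_div_iff₀' (by norm_num)]
      have hAe : A = (insert p A).erase p := (erase_insert hA).symm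
      have hpA : p ∈ insert p A := mem_insert_self _ _
      rcases hforms hAF with ⟨k, hk1, hk2, h⟩ | h | h | h
      · rw [← h] at hpA
        simp only [mem_insert, mem_Icc] at hpA
        have hA' : A = insert (p + 1) (Icc (p + 2) t) := by
          rw [hAe, ← h]
          ext m; simp only [mem_erase, mem_insert, mem_Icc]; omega
        exact hA' ▸ hform _ (by omega) (by omega)
      · have hA' : A = insert (p - 1) (Icc (p + 2) t) := by
          rw [hAe, h]
          ext m; simp only [mem_erase, mem_insert, mem_Icc]; omega
        exact hA' ▸ hform _ (by omega) (by omega)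
      · have hA' : A = insert (p - 2) (Icc (p + 2) t) := by
          rw [hAe, h]
          ext m; simp only [mem_erase, mem_insert, mem_Icc]; omega
        exact hA' ▸ hform _ (by omega) (by omega)
      -- The one form whose link has p+1 in place of p+2: here the factor 0.78 is needed, as 0.78
      -- x_{p+1} ≤ 0.78 x_1 ≤ x_{p+2}.
      · have hA' : A = insert (p - 1) (insert (p + 1) (Icc (p + 3) t)) := by
          rw [hAe, h]
          ext m; simp only [mem_erase, mem_insert, mem_Icc]; omega
        rw [hA', prod_insert (by simp; omega), prod_insert (by simp)]
        have e1 := hanti 1 (p - 1) (by omega) (by omega) (by omega)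
        have e2 : 0.78 * x (p + 1) ≤ x (p + 2) := by
          have := hanti 1 (p + 1) (by omega) (by omega) (by omega)
          linarith
        calc 0.78 * (x (p - 1) * (x (p + 1) * R)) = x (p - 1) * (0.78 * x (p + 1) * R) := by ring
          _ ≤ _ := by gcongr
  · exact hG.mul_pairLink_le hpos le_rfl (by omega) (by omega) (by omega) (by omega)
      (hanti _ _ (by omega) (by omega) (by omega)) (mem_Icc.2 ⟨by omega, by omega⟩)

theorem edgeSum_le_of_isMax (hr : 4 ≤ r) (ha : 12 ≤ a) (hap : a ≤ p) (ht : t + 1 = p + r)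
    (hG : G.LeftCompressed) (hx : x ∈ RGraph.simplex t)
    (hmax : ∀ y ∈ RGraph.simplex t, G.lagrangePoly y ≤ G.lagrangePoly x)
    (hpos : ∀ k ∈ Icc 1 t, 0 < x k)
    (hcard : #((Icc 1 t).powersetCard r \ G.edges) = a)
    (hU : #(((Icc 1 t).powersetCard r \ G.edges) \ colexTop p t a) ≤ 2) :
    edgeSum G.edges x ≤ edgeSum ((Icc 1 t).powersetCard r \ colexTop p t a) x := by
  have hanti := antitone_of_isMax hr (by omega) ht hG hx hmax hpos hcard hU
  have hsq := mul_le_sq_of_isMax hr ha hap ht hG hx hmax hpos hcard hU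
  have hpos' : ∀ k, 1 ≤ k → k ≤ t → 0 < x k := fun k h1 h2 => hpos k (mem_Icc.2 ⟨h1, h2⟩)
  set F := (Icc 1 t).powersetCard r \ G.edges with hF
  have e1 := sum_sdiff (f := fun e => ∏ k ∈ e, x k) G.edges_subset
  have e2 := sum_sdiff (f := fun e => ∏ k ∈ e, x k)
    (colexTop_subset ht hap (by omega : 1 ≤ r))
  have hQ := prod_Icc_eq_mul (x := x) (show p + 2 ≤ t by omega)
  have hR0 : 0 < ∏ k ∈ Icc (p + 3) t, x k :=
    prod_pos fun k hk => hpos k (by simp at hk ⊢; omega)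
  have hp0 := hpos' p (by omega) (by omega)
  have hz0 := hpos' (p + 1) (by omega) (by omega)
  have hy0 := hpos' (p + 2) (by omega) (by omega)
  have hQ0 : 0 < ∏ k ∈ Icc (p + 2) t, x k := hQ ▸ mul_pos hy0 hR0
  have key : ∑ e ∈ colexTop p t a, ∏ k ∈ e, x k ≤ ∑ e ∈ F, ∏ k ∈ e, x k := by
    rw [← sum_sdiff_le_sum_sdiff]
    calc _ ≤ #(colexTop p t a \ F) • (x 1 * x (p + 1) * ∏ k ∈ Icc (p + 2) t, x k) := by
          refine sum_le_card_nsmul _ _ _ fun B hB => ?_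
          obtain ⟨k, hk1, hk2, rfl⟩ := mem_colexTop.1 (mem_sdiff.1 hB).1
          rw [prod_insert (by simp; omega), prod_Icc_eq_mul (by omega), mul_assoc]
          have := hanti 1 k (by omega) (by omega) (by omega)
          gcongr
      _ ≤ #(colexTop p t a \ F) • (x p ^ 2 * ∏ k ∈ Icc (p + 2) t, x k) := by gcongr
      _ = #(F \ colexTop p t a) • (x p ^ 2 * ∏ k ∈ Icc (p + 2) t, x k) := by
          rw [card_sdiff_comm (hcard.trans (card_colexTop hap).symm)]
      _ ≤ _ := by
          refine card_nsmul_le_sum _ _ _ fun B hB => ?_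
          have f1 := hanti (p - 1) p (by omega) (by omega) (by omega)
          have f2 := hanti (p - 2) p (by omega) (by omega) (by omega)
          have f3 := hanti (p + 1) (p + 2) (by omega) (by omega) (by omega)
          rcases eq_of_mem_sdiff_colexTop hr (by omega) ht sdiff_subset hG.shiftClosed hcard hU hB
            with rfl | rfl | rfl
          · rw [prod_insert (by simp; omega), prod_insert (by simp), sq, mul_assoc]
            gcongr
          · rw [prod_insert (by simp; omega), prod_insert (by simp), sq, mul_assoc]
            gcongr
          · rw [prod_insert (by simp; omega), prod_insert (by simp), prod_insert (by simp), sq,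
              mul_assoc, hQ]
            have := hpos' (p - 1) (by omega) (by omega)
            gcongr
  simp only [edgeSum]
  linarith

end

/-! ### Vanishing weights, the edges of C_{r,m}, and the conclusion -/

/-- A weighting with a zero weight is dominated by one whose last weight vanishes. -/
theorem exists_edgeSum_le_of_zero {r p t a : ℕ} (hpt : p < t) {E : Finset (Finset ℕ)}
    (hE : E ⊆ (Icc 1 t).powersetCard r) {x : ℕ → ℝ} (hx : x ∈ RGraph.simplex t) {i : ℕ}
    (hi : i ∈ Icc 1 t) (hxi : x i = 0) :
    ∃ y ∈ RGraph.simplex t,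
      edgeSum E x ≤ edgeSum ((Icc 1 t).powersetCard r \ colexTop p t a) y := by
  set σ := Equiv.swap i t with hσ
  have htI : t ∈ Icc 1 t := mem_Icc.2 ⟨by omega, le_rfl⟩
  have hσm : ∀ k ∈ Icc 1 t, σ k ∈ Icc 1 t := by
    intro k hk
    rw [hσ, Equiv.swap_apply_def]
    split_ifs
    · exact htI
    · exact hi
    · exact hk
  have hmap : (Icc 1 t).map σ.toEmbedding = Icc 1 t := by
    refine eq_of_subset_of_card_le ?_ (by rw [card_map])
    intro k hk
    obtain ⟨l, hl, rfl⟩ := mem_map.1 hk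
    exact hσm l hl
  refine ⟨x ∘ σ, ⟨?_, fun k hk => hx.2 _ (hσm k hk)⟩, ?_⟩
  · rw [← hx.1]
    conv_rhs => rw [← hmap, sum_map]
    rfl
  have hall : edgeSum ((Icc 1 t).powersetCard r) x = edgeSum ((Icc 1 t).powersetCard r) (x ∘ σ) := by
    simp only [edgeSum]
    conv_lhs => rw [← hmap, powersetCard_map, sum_map]
    refine sum_congr rfl fun e _ => ?_
    simp [mapEmbedding_apply, prod_map]
  calc edgeSum E x ≤ edgeSum ((Icc 1 t).powersetCard r) x :=
        sum_le_sum_of_subset_of_nonneg hE fun e he _ =>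
          prod_nonneg fun k hk => hx.2 k ((mem_powersetCard.1 he).1 hk)
    _ = edgeSum ((Icc 1 t).powersetCard r) (x ∘ σ) := hall
    _ = _ := by
        -- Every member of `colexTop` contains t, whose new weight is x_i = 0.
        refine (sum_subset sdiff_subset fun e he he' => ?_).symm
        have : e ∈ colexTop p t a := by
          by_contra h
          exact he' (mem_sdiff.2 ⟨he, h⟩)
        obtain ⟨k, -, -, rfl⟩ := mem_colexTop.1 this
        refine prod_eq_zero (i := t) (mem_insert_of_mem (mem_Icc.2 ⟨by omega, le_rfl⟩)) ?_
        simp [hσ, hxi]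

/-- Some b ∈ B \ A exceeds all of A \ B. As T ⊆ A, b ≤ p, so B contains T and only its one low
vertex can differ from that of A. -/
theorem mem_colexTop_of_lt {r p t a : ℕ} (ht : t + 1 = p + r) (hr : 1 ≤ r) {A B : Finset ℕ}
    (hA : A ∈ colexTop p t a) (hB : B ∈ (Icc 1 t).powersetCard r) (hlt : toColex A < toColex B) :
    B ∈ colexTop p t a := by
  obtain ⟨k, hk1, hk2, rfl⟩ := mem_colexTop.1 hA
  obtain ⟨hB1, hB2⟩ := mem_powersetCard.1 hB
  obtain ⟨b, hb, hbA, h⟩ := Finset.Colex.toColex_lt_toColex_iff_exists_forall_lt.1 hlt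
  have hb1 := mem_Icc.1 (hB1 hb)
  simp only [mem_insert, mem_Icc, not_or] at hbA h
  have hT : Icc (p + 1) t ⊆ B := by
    intro c hc
    rw [mem_Icc] at hc
    by_contra hcB
    have := h c (Or.inr hc) hcB
    omega
  have hBb : insert b (Icc (p + 1) t) = B := by
    refine eq_of_subset_of_card_le (insert_subset hb hT) ?_
    rw [card_insert_of_notMem (by simp; omega), Nat.card_Icc, hB2]
    omega
  refine mem_colexTop.2 ⟨b, ?_, by omega, hBb⟩
  by_contra! hbk
  have hkB : k ∉ B := by
    rw [← hBb]
    simp only [mem_insert, mem_Icc]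
    omega
  have := h k (Or.inl rfl) hkB
  omega

theorem colexSegment_eq {r p t a m : ℕ} (ht : t + 1 = p + r) (hr : 1 ≤ r) (hap : a ≤ p)
    (hm : m + a = t.choose r) :
    colexSegment r m = (Icc 1 t).powersetCard r \ colexTop p t a := by
  set X := (Icc 1 t).powersetCard r \ colexTop p t a with hX
  have hXcard : #X = m := by
    rw [hX, card_sdiff_of_subset (colexTop_subset ht hap hr), card_powersetCard, card_colexTop hap,
      Nat.card_Icc, Nat.add_sub_cancel]
    omega
  have hS := card_colexSegment m hr
  refine (eq_of_subset_of_card_le ?_ (by omega)).symm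
  by_contra hnot
  obtain ⟨B, hBX, hBS⟩ := not_subset.1 hnot
  obtain ⟨A, hAS, hAX⟩ : ∃ A ∈ colexSegment r m, A ∉ X := by
    by_contra! h
    exact hBS (eq_of_subset_of_card_le h (by omega) ▸ hBX)
  obtain ⟨hB, hBT⟩ := mem_sdiff.1 hBX
  obtain ⟨hB1, hB2⟩ := mem_powersetCard.1 hB
  have hA := mem_powersetCard.1 (mem_filter.1 hAS).1
  rcases lt_trichotomy (toColex A) (toColex B) with h | h | h
  · refine hAX (mem_sdiff.2 ⟨mem_powersetCard.2 ⟨fun k hk => mem_Icc.2 ⟨?_, ?_⟩, hA.2⟩,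
      fun hAT => hBT (mem_colexTop_of_lt ht hr hAT hB h)⟩)
    · exact (mem_Icc.1 (hA.1 hk)).1
    · exact Finset.Colex.forall_le_mono h.le (fun b hb => (mem_Icc.1 (hB1 hb)).2) k hk
  · rw [toColex_inj] at h
    exact hAX (h ▸ hBX)
  · exact hBS (mem_colexSegment_of_lt hAS (fun k hk => (mem_Icc.1 (hB1 hk)).1) hB2 h)

theorem sup_colexSegment {r p t a m : ℕ} (ht : t + 1 = p + r) (hr : 3 ≤ r) (hap : a ≤ p)
    (hp : 2 ≤ p) (hm : m + a = t.choose r) :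
    ((colexSegment r m).sup fun A => A.sup id) = t := by
  rw [colexSegment_eq ht (by omega) hap hm]
  refine le_antisymm (Finset.sup_le fun A hA => Finset.sup_le fun k hk => ?_) ?_
  · exact (mem_Icc.1 ((mem_powersetCard.1 (mem_sdiff.1 hA).1).1 hk)).2
  -- An edge through t: it contains 1 and 2, both at most p, unlike any member of `colexTop`.
  · have hmem : insert t (Icc 1 (r - 1)) ∈ (Icc 1 t).powersetCard r \ colexTop p t a := by
      refine mem_sdiff.2 ⟨mem_powersetCard.2 ⟨fun k hk => ?_, ?_⟩, fun h => ?_⟩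
      · simp only [mem_insert, mem_Icc] at hk ⊢
        omega
      · rw [card_insert_of_notMem (by simp; omega), Nat.card_Icc]
        omega
      · obtain ⟨k, -, hk, h⟩ := mem_colexTop.1 h
        have h1 : 1 ∈ insert k (Icc (p + 1) t) := by rw [h]; simp; omega
        have h2 : 2 ∈ insert k (Icc (p + 1) t) := by rw [h]; simp; omega
        simp only [mem_insert, mem_Icc] at h1 h2
        omega
    exact (Finset.le_sup (f := id) (mem_insert_self t _)).trans
      (Finset.le_sup (f := fun A : Finset ℕ => A.sup id) hmem)

theorem theorem1p10 (r t m a : ℕ) (hr : 4 ≤ r) (ha : 12 ≤ a)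
    (hat : (a : ℤ) ≤ (t : ℤ) - r + 1) (hm : (m : ℤ) = (t.choose r : ℤ) - a)
    (G : RGraph r t) (hG : G.LeftCompressed) (hcard : #G.edges = m)
    (hsymm : #(G.edges ∆ (colexGraph r m).edges) ≤ 4) :
    G.lagrangian ≤ (colexGraph r m).lagrangian := by
  obtain ⟨p, ht⟩ : ∃ p, t + 1 = p + r := ⟨t + 1 - r, by omega⟩
  have hap : a ≤ p := by omega
  have hma : m + a = t.choose r := by omega
  have hseg : (colexGraph r m).edges = (Icc 1 t).powersetCard r \ colexTop p t a :=
    colexSegment_eq ht (by omega) hap hma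
  have hN := sup_colexSegment ht (by omega) hap (by omega) hma
  have hF : #((Icc 1 t).powersetCard r \ G.edges) = a := by
    rw [card_sdiff_of_subset G.edges_subset, card_powersetCard, Nat.card_Icc, hcard,
      Nat.add_sub_cancel]
    omega
  have hU : #(((Icc 1 t).powersetCard r \ G.edges) \ colexTop p t a) ≤ 2 := by
    rw [hseg] at hsymm
    have h1 : ((Icc 1 t).powersetCard r \ G.edges) \ colexTop p t a
        = ((Icc 1 t).powersetCard r \ colexTop p t a) \ G.edges := by
      rw [sdiff_sdiff_comm]
    have hcc : #G.edges = #((Icc 1 t).powersetCard r \ colexTop p t a) := by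
      rw [card_sdiff_of_subset (colexTop_subset ht hap (by omega)), card_powersetCard,
        card_colexTop hap, Nat.card_Icc, Nat.add_sub_cancel, hcard]
      omega
    have h2 := card_sdiff_comm hcc
    rw [symmDiff_def, sup_eq_union, card_union_of_disjoint disjoint_sdiff_sdiff] at hsymm
    rw [h1]
    omega
  have hC : ∀ y ∈ RGraph.simplex t, edgeSum ((Icc 1 t).powersetCard r \ colexTop p t a) y
      ≤ (colexGraph r m).lagrangian := by
    intro y hy
    refine ((colexGraph r m).isGreatest_lagrangian (by rw [hN]; omega)).2 ⟨y, ?_, ?_⟩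
    · rwa [hN]
    · rw [RGraph.lagrangePoly, hseg, edgeSum]
  obtain ⟨⟨x, hx, hxG⟩, hmax⟩ := G.isGreatest_lagrangian (by omega)
  rw [← hxG]
  change edgeSum G.edges x ≤ _
  by_cases hpos : ∀ k ∈ Icc 1 t, 0 < x k
  · exact (edgeSum_le_of_isMax hr ha hap ht hG hx
      (fun y hy => hxG ▸ hmax ⟨y, hy, rfl⟩) hpos hF hU).trans (hC x hx)
  · push Not at hpos
    obtain ⟨i, hi, hxi⟩ := hpos
    obtain ⟨y, hy, hle⟩ := exists_edgeSum_le_of_zero (p := p) (a := a) (by omega)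
      G.edges_subset hx hi (le_antisymm hxi (hx.2 i hi))
    exact hle.trans (hC y hy)
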